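/- **Setting.** Let $\gamma=\mathcal N(0,1)$. Let $\sigma:\mathbb R\to\mathbb R$ be absolutely continuous on bounded intervals with $\sigma'\in L^2(\gamma)$, normalized by $\mathbb E_{X\sim\gamma}[\sigma(X)]=0$ and $\mathbb E_{X\sim\gamma}[\sigma(X)^2]=1$, and suppose that its coefficient of nonlinearity $\mu:=1-(\mathbb E_{X\sim\gamma}[X\sigma(X)])^2$ is positive. For a function $f$ and $\rho\in[-1,1]$ let $\hat f(\rho):=\mathbb E[f(w\cdot x)f(w\cdot y)]$, where $w$ is a standard Gaussian vector and $x,y$ are unit vectors with $x\cdot y=\rho$ (equivalently, $\hat f(\rho)=\mathbb E[f(U)f(V)]$ for centred jointly Gaussian $U,V$ of unit variance and covariance $\rho$). Let $\hat\sigma^{(\ell)}$ be the $\ell$-fold composition of $\hat\sigma$, with $\hat\sigma^{(0)}=\mathrm{id}$. Let $x_1,\dots,x_n\in\mathbb R^d$ be unit vectors and $0<\delta\le 1$ with $1-|x_i\cdot x_j|\ge\delta$ for all $i\ne j$ (for instance $\delta=\min_{i\neq j}(1-|x_i\cdot x_j|)$ if this is positive). The neural tangent kernel matrix $K\in\mathbb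 R^{n\times n}$ of the infinitely wide fully-connected network with $L$ hidden layers and activation $\sigma$ has the entries $$K_{ij}=\sum_{h=1}^{L+1}\hat\sigma^{(h-1)}(\rho_{ij})\prod_{h'=h}^{L}\widehat{\sigma'}\bigl(\hat\sigma^{(h'-s)}(\rho_{ij})\bigr),\qquad \rho_{ij}=x_i\cdot x_j ,$$ where $s\in\{0,1\}$; both indexings of the derivative factors occur in the literature, and the result holds for each of them. Let $L_{\mathrm{conv}}:=8\log(n/\delta)/\mu$, and let $\kappa(K)$ be the ratio of the largest to the smallest singular value of $K$. **Claim.** (a) If $L\ge L_{\mathrm{conv}}$, then every eigenvalue $\lambda$ of the symmetric matrix $K$ satisfies $$K_{11}\Bigl(1-\frac1n\Bigr)\le\lambda\le K_{11}\Bigl(1+\frac1n\Bigr),$$ and the same holds with any other diagonal entry $K_{ii}$ in place of $K_{11}$. (b) If moreover $n\ge 2$, then $$1\le\kappa(K)\le\frac{1+1/n}{1-1/n}.$$ (c) Consequently, for $\sigma$ and $s$ fixed, along any sequence of such datasets (of any dimensions and separabilities) whose sizes $n$ tend to infinity, with depths $L\ge L_{\mathrm{conv}}$, we have $\kappa(K)\to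 1$. -/

import Mathlib

open MeasureTheory ProbabilityTheory Filter Topology

noncomputable section

/-- A normalized activation function: `𝔼 σ(X) = 0` and `𝔼 σ(X)² = 1` for `X ∼ 𝒩(0,1)`.
For its derivative to make sense (also for kinked activations such as a rescaled and recentred
ReLU), `σ` is absolutely continuous on bounded intervals; for the neural tangent kernel to be
finite on the unit sphere, `σ'(X)` is square integrable. -/
structure IsNormalizedActivation (σ : ℝ → ℝ) : Prop where
  absolutelyContinuous : ∀ a b : ℝ, AbsolutelyContinuousOnInterval σ a b
  memLp_deriv : MemLp (deriv σ) 2 (gaussianReal 0 1)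
  mean_eq_zero : ∫ t, σ t ∂(gaussianReal 0 1) = 0
  second_moment_eq_one : ∫ t, σ t ^ 2 ∂(gaussianReal 0 1) = 1

/-- The coefficient of nonlinearity `μ = 1 - (𝔼[X σ(X)])²`, `X ∼ 𝒩(0,1)`. -/
def nonlinearityCoeff (σ : ℝ → ℝ) : ℝ :=
  1 - (∫ t, t * σ t ∂(gaussianReal 0 1)) ^ 2

/-- The dual (conjugate) function of `f`: `f̂(ρ) = 𝔼[f(w·x) f(w·y)]` for a standard Gaussian
vector `w` and unit vectors `x, y` with `x·y = ρ ∈ [-1,1]`, written in the plane spanned by `x`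
and `y` with `x = (1,0)` and `y = (ρ, √(1-ρ²))`. -/
def dualActivation (f : ℝ → ℝ) (ρ : ℝ) : ℝ :=
  ∫ w : ℝ × ℝ, f w.1 * f (ρ * w.1 + √(1 - ρ ^ 2) * w.2)
    ∂((gaussianReal 0 1).prod (gaussianReal 0 1))

/-- The neural tangent kernel of the infinitely wide fully-connected network with `L` hidden
layers, as a function of the inner product `ρ` of two unit vectors:
`∑_{h=1}^{L+1} σ̂^{(h-1)}(ρ) ∏_{h'=h}^{L} (σ')^(σ̂^{(h'-s)}(ρ))`,
where `σ̂^{(ℓ)}` is the `ℓ`-fold composition and `(σ')^` is the dual of the derivative.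
The shift `s` records the two indexings of the derivative factors found in the literature:
`s = 0` and `s = 1` (the latter is the layerwise recursion). -/
def ntk (σ : ℝ → ℝ) (s L : ℕ) (ρ : ℝ) : ℝ :=
  ∑ h ∈ Finset.Icc 1 (L + 1), (dualActivation σ)^[h - 1] ρ *
    ∏ h' ∈ Finset.Icc h L, dualActivation (deriv σ) ((dualActivation σ)^[h' - s] ρ)

/-- The matrix `K` of the neural tangent kernel over the data points `x₁, …, xₙ`. -/
def ntkMatrix (σ : ℝ → ℝ) (s L : ℕ) {n d : ℕ} (x : Fin n → EuclideanSpace ℝ (Fin d)) :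
    Matrix (Fin n) (Fin n) ℝ :=
  Matrix.of fun i j => ntk σ s L (inner ℝ (x i) (x j))

theorem ntkMatrix_isHermitian (σ : ℝ → ℝ) (s L : ℕ) {n d : ℕ}
    (x : Fin n → EuclideanSpace ℝ (Fin d)) : (ntkMatrix σ s L x).IsHermitian := by
  ext i j
  simp [ntkMatrix, real_inner_comm]

/-- Separability of two data points, `δ_{ij} = 1 - |xᵢ·xⱼ|`. -/
def separability {d : ℕ} (x y : EuclideanSpace ℝ (Fin d)) : ℝ := 1 - |inner ℝ x y|

/-- Unit vectors that are pairwise separated by at least `δ ∈ (0, 1]`. -/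
structure IsSeparatedDataset {n d : ℕ} (x : Fin n → EuclideanSpace ℝ (Fin d)) (δ : ℝ) :
    Prop where
  norm_eq_one : ∀ i, ‖x i‖ = 1
  pos : 0 < δ
  le_one : δ ≤ 1
  le_separability : ∀ i j, i ≠ j → δ ≤ separability (x i) (x j)

/-- The depth `L_conv = 8 log(n/δ) / μ`. -/
def convDepth (σ : ℝ → ℝ) (n : ℕ) (δ : ℝ) : ℝ :=
  8 * Real.log (n / δ) / nonlinearityCoeff σ

/-- The condition number of an `n × n` real matrix: the ratio of its largest to its smallest
singular value. (The singular values are indexed from `0` in decreasing order.) -/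
def condNumber {n : ℕ} (A : Matrix (Fin n) (Fin n) ℝ) : ℝ :=
  (Matrix.toEuclideanLin A).singularValues 0 / (Matrix.toEuclideanLin A).singularValues (n - 1)

end

/-! Write `a_k` for the normalized Hermite coefficients of `σ`. Mehler's formula gives `σ̂(ρ) = ∑
a_k² ρ^k`, where `a_0 = 0`, `a_1² = 1 - μ` and the `a_k²` sum to `1`. Bounding `|ρ|^k` by `|ρ|²` for
`k ≥ 2` gives `|σ̂(ρ)| ≤ φ(|ρ|)` with `φ(r) = r (1 - μ (1 - r))`. The dual of `σ'` is `∑ (k+1)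
a_{k+1}² ρ^k`; with `M ≥ 1` its value at `1`, it is at most `M (1 - μ (1 - |ρ|))` in absolute value.

The contraction factor is the same in both bounds (`abs_dualActivation_le`,
`abs_dualActivation_deriv_le`). Hence a derivative factor shrinks a summand of the kernel as much as
one more layer would, up to the factor `M`, and the summand with index `h` is at most `M^(L+1-h)
φ^[L](|ρ|)`. At `ρ = 1` the summands are exactly `M^(L+1-h)`, so `|K(ρ)| ≤ K(1) φ^[L](|ρ|)`, however
large `M` is.

The odds `r / (1 - r)` fall by the factor `1 + μ` under `φ`, so at depth `L_conv` the off-diagonal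
entries are at most `K(1) / n²`. Gershgorin's theorem puts the spectrum within `K(1) / n` of `K(1)`.
-/

/-! ### Eigenvalues and singular values of nearly scalar symmetric matrices. -/

/-- Two-sided Gershgorin bound for a matrix with constant diagonal `c` and off-diagonal entries of
absolute value at most `ε`. -/
theorem abs_eigenvalue_sub_le_of_offDiag_le {n : ℕ} {A : Matrix (Fin n) (Fin n) ℝ} {c ε t : ℝ}
    (hdiag : ∀ i, A i i = c) (hoff : ∀ i j, i ≠ j → |A i j| ≤ ε)
    (ht : Module.End.HasEigenvalue (Matrix.toLin' A) t) : |t - c| ≤ ((n : ℝ) - 1) * ε := by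
  obtain ⟨k, hk⟩ := eigenvalue_mem_ball ht
  rw [Metric.mem_closedBall, Real.dist_eq, hdiag] at hk
  refine hk.trans ?_
  have h1 : ∑ j ∈ Finset.univ.erase k, ‖A k j‖ ≤ ∑ j ∈ Finset.univ.erase k, ε :=
    Finset.sum_le_sum fun j hj => hoff k j (Finset.ne_of_mem_erase hj).symm
  have hn : 1 ≤ n := Nat.one_le_of_lt k.2
  simpa [Finset.card_erase_of_mem, Nat.cast_sub hn] using h1

theorem hasEigenvalue_toLin'_eigenvalues {n : ℕ} {A : Matrix (Fin n) (Fin n) ℝ}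
    (hA : A.IsHermitian) (j : Fin n) :
    Module.End.HasEigenvalue (Matrix.toLin' A) (hA.eigenvalues j) := by
  refine Module.End.hasEigenvalue_of_hasEigenvector (x := (hA.eigenvectorBasis j).ofLp) ?_
  refine ⟨Module.End.mem_eigenspace_iff.2 ?_, ?_⟩
  · simpa using hA.mulVec_eigenvectorBasis j
  · have := hA.eigenvectorBasis.orthonormal.ne_zero j
    simpa using this

/-- A singular value of a symmetric matrix is, up to sign, an eigenvalue. -/
theorem hasEigenvalue_singularValues_or_neg {n : ℕ} {A : Matrix (Fin n) (Fin n) ℝ}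
    (hA : A.IsHermitian) {i : ℕ} (hi : i < n) :
    Module.End.HasEigenvalue (Matrix.toLin' A) ((Matrix.toEuclideanLin A).singularValues i) ∨
    Module.End.HasEigenvalue (Matrix.toLin' A) (-(Matrix.toEuclideanLin A).singularValues i) := by
  set t := (Matrix.toEuclideanLin A).singularValues i
  have hev := (Matrix.toEuclideanLin A).hasEigenvalue_adjoint_comp_self_sq_singularValues
    (n := i) (by simpa using hi)
  obtain ⟨v, hv, hv0⟩ := hev.exists_hasEigenvector
  rw [Module.End.mem_eigenspace_iff] at hv
  have hadj : LinearMap.adjoint (Matrix.toEuclideanLin A) = Matrix.toEuclideanLin A := by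
    rw [← Matrix.toEuclideanLin_conjTranspose_eq_adjoint, hA.eq]
  rw [hadj] at hv
  have hv' : A.mulVec (A.mulVec v.ofLp) = t ^ 2 • v.ofLp := by
    have := congrArg WithLp.ofLp hv
    simpa [Matrix.toLpLin_apply] using this
  have hw0 : v.ofLp ≠ 0 := by simpa using hv0
  -- Here `(A + t)(A - t) v = 0` with `v ≠ 0`: either `v` is an eigenvector for `t`, or `(A - t) v`
  -- is one for `-t`.
  by_cases hz : A.mulVec v.ofLp - t • v.ofLp = 0
  · left
    refine Module.End.hasEigenvalue_of_hasEigenvector (x := v.ofLp) ⟨?_, hw0⟩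
    rw [Module.End.mem_eigenspace_iff, Matrix.toLin'_apply]
    exact sub_eq_zero.1 hz
  · right
    refine Module.End.hasEigenvalue_of_hasEigenvector
      (x := A.mulVec v.ofLp - t • v.ofLp) ⟨?_, hz⟩
    rw [Module.End.mem_eigenspace_iff, Matrix.toLin'_apply, Matrix.mulVec_sub, hv',
      Matrix.mulVec_smul]
    module

theorem condNumber_mem_Icc {n : ℕ} (hn : 2 ≤ n) {A : Matrix (Fin n) (Fin n) ℝ}
    (hA : A.IsHermitian) {c : ℝ} (hc : 0 < c)
    (h : ∀ t, Module.End.HasEigenvalue (Matrix.toLin' A) t → |t - c| ≤ c / n) :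
    1 ≤ condNumber A ∧ condNumber A ≤ (1 + 1 / n) / (1 - 1 / n) := by
  have hn' : (2 : ℝ) ≤ n := by exact_mod_cast hn
  have hinv : (1 : ℝ) / n ≤ 1 / 2 := one_div_le_one_div_of_le (by norm_num) hn'
  have hlow : 0 < c * (1 - 1 / n) := mul_pos hc (by linarith)
  have key : ∀ i < n, c * (1 - 1 / n) ≤ (Matrix.toEuclideanLin A).singularValues i ∧
      (Matrix.toEuclideanLin A).singularValues i ≤ c * (1 + 1 / n) := by
    intro i hi
    have h0 := (Matrix.toEuclideanLin A).singularValues_nonneg i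
    have hdiv : c / n = c * (1 / n) := by ring
    rcases hasEigenvalue_singularValues_or_neg hA hi with h1 | h1
    · have := abs_le.1 (h _ h1)
      constructor <;> nlinarith
    -- Impossible case: every eigenvalue is at least `c (1 - 1/n) > 0`, while the negative of a
    -- singular value is at most `0`.
    · have := abs_le.1 (h _ h1)
      nlinarith
  have k0 := key 0 (by omega)
  have k1 := key (n - 1) (by omega)
  have hpos : 0 < (Matrix.toEuclideanLin A).singularValues (n - 1) := hlow.trans_le k1.1
  refine ⟨(one_le_div hpos).2 ((Matrix.toEuclideanLin A).singularValues_antitone (Nat.zero_le _)),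
    ?_⟩
  calc condNumber A ≤ (c * (1 + 1 / n)) / (c * (1 - 1 / n)) :=
        div_le_div₀ (hlow.le.trans (k0.1.trans k0.2)) k0.2 hlow k1.1
    _ = _ := mul_div_mul_left _ _ hc.ne'

/-! ### The scalar comparison dynamics. -/

/-- The comparison dynamics `r ↦ r (1 - μ (1 - r))` for the inner products along the layers. -/
def logisticStep (μ r : ℝ) : ℝ := r * (1 - μ * (1 - r))

section logistic

variable {μ : ℝ} (h0 : 0 < μ) (h1 : μ ≤ 1)
include h0 h1

theorem logisticStep_mem {r : ℝ} (hr : r ∈ Set.Icc (0 : ℝ) 1) :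
    logisticStep μ r ∈ Set.Icc (0 : ℝ) r := by
  obtain ⟨hr0, hr1⟩ := hr
  have h2 : μ * (1 - r) ≤ 1 := by nlinarith
  have h3 : 0 ≤ μ * (1 - r) := mul_nonneg h0.le (by linarith)
  unfold logisticStep
  constructor <;> nlinarith

theorem logisticStep_mono {r r' : ℝ} (hr : 0 ≤ r) (hrr : r ≤ r') :
    logisticStep μ r ≤ logisticStep μ r' := by
  unfold logisticStep
  have h2 : 0 ≤ 1 - μ * (1 - r) := by nlinarith
  have h3 : 0 ≤ μ * (r' - r) := mul_nonneg h0.le (by linarith)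
  nlinarith

theorem logisticStep_iterate_mem {r : ℝ} (hr : r ∈ Set.Icc (0 : ℝ) 1) (l : ℕ) :
    (logisticStep μ)^[l] r ∈ Set.Icc (0 : ℝ) 1 := by
  induction l with
  | zero => exact hr
  | succ l ih =>
    rw [Function.iterate_succ_apply']
    have := logisticStep_mem h0 h1 ih
    exact ⟨this.1, this.2.trans ih.2⟩

/-- The odds `r / (1 - r)` decay by the factor `1 + μ` in each step. -/
theorem logisticStep_iterate_odds {δ r : ℝ} (hδ : 0 < δ) (hr : r ∈ Set.Icc (0 : ℝ) 1)
    (hrδ : r ≤ 1 - δ) (l : ℕ) :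
    (logisticStep μ)^[l] r * (δ * (1 + μ) ^ l) ≤ 1 - (logisticStep μ)^[l] r := by
  induction l with
  | zero =>
    obtain ⟨h2, h3⟩ := hr
    simp only [Function.iterate_zero, id, pow_zero, mul_one]
    nlinarith
  | succ l ih =>
    rw [Function.iterate_succ_apply']
    obtain ⟨h2, h3⟩ := logisticStep_iterate_mem h0 h1 hr l
    generalize (logisticStep μ)^[l] r = q at *
    have h4 : 0 ≤ 1 - μ * (1 - q) := by nlinarith
    calc logisticStep μ q * (δ * (1 + μ) ^ (l + 1))
        = q * (δ * (1 + μ) ^ l) * ((1 - μ * (1 - q)) * (1 + μ)) := by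
          unfold logisticStep; ring
      _ ≤ (1 - q) * ((1 - μ * (1 - q)) * (1 + μ)) := by gcongr
      -- The two sides differ by `(1 - q)` times `μ² (1 - q)`.
      _ ≤ (1 - q) * (1 + μ * q) := by
          apply mul_le_mul_of_nonneg_left _ (by linarith)
          nlinarith [mul_nonneg (sq_nonneg μ) (sub_nonneg.2 h3)]
      _ = 1 - logisticStep μ q := by unfold logisticStep; ring

end logistic

/-- Since `log (1 + μ) ≥ μ / (1 + μ) ≥ μ / 2`, the depth gives `L log (1 + μ) ≥ 4 (log n - log δ)`,
which exceeds the required `2 log n - log δ` because `n ≥ 1` and `δ ≤ 1`. -/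
theorem sq_le_mul_one_add_pow {μ δ : ℝ} {n L : ℕ} (h0 : 0 < μ) (h1 : μ ≤ 1) (hδ : 0 < δ)
    (hδ1 : δ ≤ 1) (hn : 1 ≤ n) (hL : 8 * Real.log (n / δ) / μ ≤ L) :
    (n : ℝ) ^ 2 ≤ δ * (1 + μ) ^ L := by
  have hn0 : (0 : ℝ) < n := by exact_mod_cast hn
  have hlogn : 0 ≤ Real.log n := Real.log_nonneg (by exact_mod_cast hn)
  have hlogδ : Real.log δ ≤ 0 := Real.log_nonpos hδ.le hδ1
  have hlogμ : μ / 2 ≤ Real.log (1 + μ) := by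
    have h2 := Real.one_sub_inv_le_log_of_pos (show 0 < 1 + μ by linarith)
    have h3 : 1 - (1 + μ)⁻¹ = μ / (1 + μ) := by field_simp; ring
    rw [h3] at h2
    exact (div_le_div_of_nonneg_left h0.le (by linarith) (by linarith)).trans h2
  rw [div_le_iff₀ h0, Real.log_div hn0.ne' hδ.ne'] at hL
  rw [← Real.log_le_log_iff (by positivity) (by positivity), Real.log_mul hδ.ne' (by positivity),
    Real.log_pow, Real.log_pow]
  have h4 : (L : ℝ) * (μ / 2) ≤ L * Real.log (1 + μ) := by gcongr
  push_cast
  linarith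

/-! ### Comparison of the kernel with the scalar dynamics. -/

/-- The kernel attached to a pair of functions in the place of `σ̂` and the dual of `σ'`. -/
def ntkSum (f g : ℝ → ℝ) (s L : ℕ) (ρ : ℝ) : ℝ :=
  ∑ h ∈ Finset.Icc 1 (L + 1), f^[h - 1] ρ * ∏ h' ∈ Finset.Icc h L, g (f^[h' - s] ρ)

section comparison

variable {f g : ℝ → ℝ} {μ M : ℝ} (h0 : 0 < μ) (h1 : μ ≤ 1)
  (hf : ∀ ρ, |ρ| ≤ 1 → |f ρ| ≤ logisticStep μ |ρ|)
  (hg : ∀ ρ, |ρ| ≤ 1 → |g ρ| ≤ M * (1 - μ * (1 - |ρ|)))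

include h0 h1 hf in
theorem abs_iterate_le_logisticStep_iterate {ρ : ℝ} (hρ : |ρ| ≤ 1) (l : ℕ) :
    |f^[l] ρ| ≤ (logisticStep μ)^[l] |ρ| := by
  induction l with
  | zero => simp
  | succ l ih =>
    have hm := logisticStep_iterate_mem h0 h1 ⟨abs_nonneg ρ, hρ⟩ l
    rw [Function.iterate_succ_apply', Function.iterate_succ_apply']
    exact (hf _ (ih.trans hm.2)).trans (logisticStep_mono h0 h1 (abs_nonneg _) ih)

include h0 h1 hf hg in
-- Each factor of the product costs `M` and advances the comparison dynamics by one step, because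
-- the bound on `g` contains the very factor that `logisticStep` multiplies by.
theorem abs_term_le (hM : 0 ≤ M) {ρ : ℝ} (hρ : |ρ| ≤ 1) {s : ℕ} (hs : s ≤ 1) (h k : ℕ) :
    |f^[h] ρ * ∏ h' ∈ Finset.Icc (h + 1) (h + k), g (f^[h' - s] ρ)| ≤
      M ^ k * (logisticStep μ)^[h + k] |ρ| := by
  have hm := logisticStep_iterate_mem h0 h1 (r := |ρ|) ⟨abs_nonneg ρ, hρ⟩
  induction k with
  | zero => simpa using abs_iterate_le_logisticStep_iterate h0 h1 hf hρ h
  | succ k ih =>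
    rw [← add_assoc, Finset.prod_Icc_succ_top (by omega), ← mul_assoc, abs_mul]
    -- The two indexings meet here: equality for `s = 1`, and for `s = 0` one further step of a
    -- decreasing orbit.
    have hle : (logisticStep μ)^[h + k + 1 - s] |ρ| ≤ (logisticStep μ)^[h + k] |ρ| := by
      interval_cases s
      · rw [Nat.sub_zero, Function.iterate_succ_apply']
        exact (logisticStep_mem h0 h1 (hm _)).2
      · simp
    have hgb : |g (f^[h + k + 1 - s] ρ)| ≤ M * (1 - μ * (1 - (logisticStep μ)^[h + k] |ρ|)) := by
      have h2 := abs_iterate_le_logisticStep_iterate h0 h1 hf hρ (h + k + 1 - s)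
      refine (hg _ (h2.trans (hm _).2)).trans ?_
      have h3 := h2.trans hle
      gcongr
    have h4 : 0 ≤ (logisticStep μ)^[h + k] |ρ| := (hm _).1
    calc _ ≤ (M ^ k * (logisticStep μ)^[h + k] |ρ|) *
          (M * (1 - μ * (1 - (logisticStep μ)^[h + k] |ρ|))) := by gcongr
      _ = M ^ (k + 1) * (logisticStep μ)^[h + k + 1] |ρ| := by
        rw [Function.iterate_succ_apply']
        unfold logisticStep
        ring

include h0 h1 hf hg in
theorem abs_ntkSum_le (hM : 0 ≤ M) {ρ : ℝ} (hρ : |ρ| ≤ 1) {s : ℕ} (hs : s ≤ 1) (L : ℕ) :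
    |ntkSum f g s L ρ| ≤
      (∑ h ∈ Finset.Icc 1 (L + 1), M ^ (L + 1 - h)) * (logisticStep μ)^[L] |ρ| := by
  unfold ntkSum
  rw [Finset.sum_mul]
  refine (Finset.abs_sum_le_sum_abs _ _).trans (Finset.sum_le_sum fun h hh => ?_)
  obtain ⟨ha, hb⟩ := Finset.mem_Icc.1 hh
  have := abs_term_le h0 h1 hf hg hM hρ hs (h - 1) (L + 1 - h)
  rwa [show h - 1 + 1 = h by omega, show h - 1 + (L + 1 - h) = L by omega] at this

end comparison

/-- As `1` is a fixed point of `f`, the diagonal value is the same geometric sum that appears in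
`abs_ntkSum_le` with `M = g 1`. -/
theorem ntkSum_one {f g : ℝ → ℝ} (hf : f 1 = 1) (s L : ℕ) :
    ntkSum f g s L 1 = ∑ h ∈ Finset.Icc 1 (L + 1), g 1 ^ (L + 1 - h) := by
  unfold ntkSum
  have hit : ∀ l, f^[l] 1 = 1 := fun l => Function.iterate_fixed hf l
  exact Finset.sum_congr rfl fun h _ => by simp [hit]

theorem ntkSum_one_pos {f g : ℝ → ℝ} (hf : f 1 = 1) (hg : 0 ≤ g 1) (s L : ℕ) :
    0 < ntkSum f g s L 1 := by
  rw [ntkSum_one hf]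
  refine Finset.sum_pos' (fun i _ => pow_nonneg hg _) ⟨L + 1, by simp, by simp⟩

theorem abs_ntkSum_le_of_separated {f g : ℝ → ℝ} {μ : ℝ} (h0 : 0 < μ) (h1 : μ ≤ 1)
    (hf : ∀ ρ, |ρ| ≤ 1 → |f ρ| ≤ logisticStep μ |ρ|)
    (hg : ∀ ρ, |ρ| ≤ 1 → |g ρ| ≤ g 1 * (1 - μ * (1 - |ρ|)))
    (hf1 : f 1 = 1) (hg1 : 0 ≤ g 1) {δ ρ : ℝ} {n s L : ℕ} (hs : s ≤ 1) (hδ : 0 < δ) (hδ1 : δ ≤ 1)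
    (hn : 1 ≤ n) (hL : 8 * Real.log (n / δ) / μ ≤ L) (hρ : δ ≤ 1 - |ρ|) :
    |ntkSum f g s L ρ| ≤ ntkSum f g s L 1 / (n : ℝ) ^ 2 := by
  have hρ1 : |ρ| ≤ 1 := by linarith
  have hn0 : (0 : ℝ) < n := by exact_mod_cast hn
  refine (abs_ntkSum_le h0 h1 hf hg hg1 hρ1 hs L).trans ?_
  rw [← ntkSum_one hf1 s, div_eq_mul_inv]
  refine mul_le_mul_of_nonneg_left ?_ (ntkSum_one_pos hf1 hg1 s L).le
  have hodds := logisticStep_iterate_odds h0 h1 hδ ⟨abs_nonneg ρ, hρ1⟩ (by linarith) L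
  have hpos := (logisticStep_iterate_mem h0 h1 (r := |ρ|) ⟨abs_nonneg ρ, hρ1⟩ L).1
  have hpow := sq_le_mul_one_add_pow h0 h1 hδ hδ1 hn hL
  rw [← one_div, le_div_iff₀ (by positivity)]
  -- With `q` the iterate, `q n² ≤ q δ (1 + μ)^L ≤ 1 - q ≤ 1`.
  nlinarith

/-! ### Gaussian integration by parts. -/

theorem integrable_gaussianReal_iff {f : ℝ → ℝ} :
    Integrable f (gaussianReal 0 1) ↔ Integrable fun x => gaussianPDFReal 0 1 x * f x := by
  rw [gaussianReal_of_var_ne_zero _ one_ne_zero,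
    integrable_withDensity_iff_integrable_smul' (measurable_gaussianPDF _ _)
      (ae_of_all _ fun _ => gaussianPDF_lt_top)]
  simp

theorem hasDerivAt_gaussianPDFReal_std (x : ℝ) :
    HasDerivAt (gaussianPDFReal 0 1) (-x * gaussianPDFReal 0 1 x) x := by
  rw [gaussianPDFReal_def]
  have h := ((((hasDerivAt_id x).sub_const 0).pow 2).neg.div_const (2 * ((1 : NNReal) : ℝ))).exp
    |>.const_mul (√(2 * Real.pi * ((1 : NNReal) : ℝ)))⁻¹
  convert! h using 1
  · simp
    ring

theorem contDiff_gaussianPDFReal_std : ContDiff ℝ 1 (gaussianPDFReal 0 1) := by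
  rw [gaussianPDFReal_def]
  fun_prop

/-- If an absolutely continuous function and its derivative are integrable over `ℝ`, then the
derivative integrates to zero. -/
theorem integral_deriv_eq_zero_of_absolutelyContinuous {G : ℝ → ℝ}
    (hG : ∀ a b, AbsolutelyContinuousOnInterval G a b) (h1 : Integrable G)
    (h2 : Integrable (deriv G)) : ∫ x, deriv G x = 0 := by
  have htop : Tendsto (fun b => ∫ x in (0 : ℝ)..b, deriv G x) atTop
      (𝓝 (∫ x in Set.Ioi (0 : ℝ), deriv G x)) :=
    intervalIntegral_tendsto_integral_Ioi 0 h2.integrableOn tendsto_id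
  have hbot : Tendsto (fun a => ∫ x in a..(0 : ℝ), deriv G x) atBot
      (𝓝 (∫ x in Set.Iic (0 : ℝ), deriv G x)) :=
    intervalIntegral_tendsto_integral_Iic 0 h2.integrableOn tendsto_id
  simp only [(hG _ _).integral_deriv_eq_sub] at htop hbot
  have e1 : (∫ x in Set.Ioi (0 : ℝ), deriv G x) + G 0 = 0 := by
    have ht : Tendsto G atTop (𝓝 ((∫ x in Set.Ioi (0 : ℝ), deriv G x) + G 0)) := by
      simpa using htop.add_const (G 0)
    -- Integrability of the derivative makes `G` converge at infinity, and the limit of an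
    -- integrable function on a half-line of infinite measure must be `0`.
    refine IntegrableAtFilter.eq_zero_of_tendsto (μ := volume)
      (h1.integrableAtFilter atTop) (fun s hs => ?_) ht
    obtain ⟨b, hb⟩ := mem_atTop_sets.1 hs
    rw [← top_le_iff, ← Real.volume_Ici (a := b)]
    exact measure_mono hb
  have e2 : G 0 - (∫ x in Set.Iic (0 : ℝ), deriv G x) = 0 := by
    have ht : Tendsto G atBot (𝓝 (G 0 - ∫ x in Set.Iic (0 : ℝ), deriv G x)) := by
      simpa using hbot.const_sub (G 0)
    refine IntegrableAtFilter.eq_zero_of_tendsto (μ := volume)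
      (h1.integrableAtFilter atBot) (fun s hs => ?_) ht
    obtain ⟨b, hb⟩ := mem_atBot_sets.1 hs
    rw [← top_le_iff, ← Real.volume_Iic (a := b)]
    exact measure_mono hb
  rw [← intervalIntegral.integral_Iic_add_Ioi h2.integrableOn h2.integrableOn (b := 0)]
  linarith

theorem ae_differentiableAt_of_absolutelyContinuous {F : ℝ → ℝ}
    (hF : ∀ a b, AbsolutelyContinuousOnInterval F a b) : ∀ᵐ x, DifferentiableAt ℝ F x := by
  have hdiff : ∀ᵐ x, ∀ n : ℕ, x ∈ Set.uIcc (-(n : ℝ)) n → DifferentiableAt ℝ F x :=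
    ae_all_iff.2 fun n => (hF _ _).ae_differentiableAt
  filter_upwards [hdiff] with x hx
  obtain ⟨n, hn⟩ := exists_nat_ge |x|
  refine hx n ?_
  rw [Set.uIcc_of_le (by linarith [abs_nonneg x])]
  exact abs_le.1 hn

/-- Gaussian integration by parts (Stein's identity) for absolutely continuous functions. -/
theorem integral_id_mul_gaussianReal_eq_integral_deriv {F : ℝ → ℝ}
    (hF : ∀ a b, AbsolutelyContinuousOnInterval F a b)
    (h1 : Integrable F (gaussianReal 0 1)) (h2 : Integrable (deriv F) (gaussianReal 0 1))
    (h3 : Integrable (fun x => x * F x) (gaussianReal 0 1)) :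
    ∫ x, x * F x ∂(gaussianReal 0 1) = ∫ x, deriv F x ∂(gaussianReal 0 1) := by
  have hφ : ∀ a b, AbsolutelyContinuousOnInterval (gaussianPDFReal 0 1) a b := fun a b =>
    contDiff_gaussianPDFReal_std.contDiffOn.absolutelyContinuousOnInterval
  rw [integrable_gaussianReal_iff] at h1 h2 h3
  have hd : deriv (fun x => gaussianPDFReal 0 1 x * F x) =ᵐ[volume]
      fun x => gaussianPDFReal 0 1 x * deriv F x - gaussianPDFReal 0 1 x * (x * F x) := by
    filter_upwards [ae_differentiableAt_of_absolutelyContinuous hF] with x hxd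
    rw [((hasDerivAt_gaussianPDFReal_std x).fun_mul hxd.hasDerivAt).deriv]
    ring
  have hz := integral_deriv_eq_zero_of_absolutelyContinuous
    (fun a b => (hφ a b).fun_mul (hF a b)) h1 ((h2.sub h3).congr hd.symm)
  rw [integral_congr_ae hd, integral_sub h2 h3] at hz
  simp only [integral_gaussianReal_eq_integral_smul (one_ne_zero (α := NNReal)), smul_eq_mul]
  linarith

/-! ### Hermite polynomials: orthogonality and Mehler's kernel. -/

/-- The probabilists' Hermite polynomials with real coefficients. -/
noncomputable def hermiteR (k : ℕ) : Polynomial ℝ :=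
  (Polynomial.hermite k).map (Int.castRingHom ℝ)

theorem hermiteR_zero : hermiteR 0 = 1 := by simp [hermiteR]

theorem hermiteR_succ (k : ℕ) :
    hermiteR (k + 1) = Polynomial.X * hermiteR k - Polynomial.derivative (hermiteR k) := by
  simp [hermiteR, Polynomial.hermite_succ, Polynomial.derivative_map]

theorem hermiteR_one : hermiteR 1 = Polynomial.X := by simp [hermiteR]

theorem derivative_hermiteR_succ (k : ℕ) :
    Polynomial.derivative (hermiteR (k + 1)) = ((k : Polynomial ℝ) + 1) * hermiteR k := by
  induction k with
  | zero => simp [hermiteR_one, hermiteR_zero]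
  | succ k ih =>
    rw [hermiteR_succ (k + 1), Polynomial.derivative_sub, Polynomial.derivative_mul, ih,
      Polynomial.derivative_mul, hermiteR_succ k]
    simp
    ring

theorem degree_hermiteR (k : ℕ) : (hermiteR k).degree = k := by
  rw [hermiteR, (Polynomial.hermite_monic k).degree_map, Polynomial.degree_hermite]

theorem integrable_pow_gaussianReal (n : ℕ) :
    Integrable (fun x : ℝ => x ^ n) (gaussianReal 0 1) := by
  have := integrable_pow_of_mem_interior_integrableExpSet (X := id) (μ := gaussianReal 0 1)
    (by simp [integrableExpSet_id_gaussianReal]) n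
  simpa using this

theorem integrable_eval_gaussianReal (p : Polynomial ℝ) :
    Integrable (fun x => p.eval x) (gaussianReal 0 1) := by
  simp only [Polynomial.eval_eq_sum_range]
  exact integrable_finsetSum _ fun i _ => (integrable_pow_gaussianReal i).const_mul _

theorem memLp_eval_gaussianReal (p : Polynomial ℝ) :
    MemLp (fun x => p.eval x) 2 (gaussianReal 0 1) := by
  rw [memLp_two_iff_integrable_sq p.continuous.aestronglyMeasurable]
  exact (integrable_eval_gaussianReal (p ^ 2)).congr (ae_of_all _ fun x => Polynomial.eval_pow 2)

theorem absolutelyContinuousOnInterval_eval (p : Polynomial ℝ) (a b : ℝ) :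
    AbsolutelyContinuousOnInterval (fun x => p.eval x) a b :=
  (p.contDiff_aeval (n := 1) (𝕜 := ℝ)).contDiffOn.absolutelyContinuousOnInterval

/-- Differentiation lowers Hermite coefficients: `𝔼[F He_{k+1}] = 𝔼[F' He_k]`. -/
theorem integral_mul_hermiteR_succ {F : ℝ → ℝ}
    (hF : ∀ a b, AbsolutelyContinuousOnInterval F a b)
    (h1 : MemLp F 2 (gaussianReal 0 1)) (h2 : MemLp (deriv F) 2 (gaussianReal 0 1)) (k : ℕ) :
    ∫ x, F x * (hermiteR (k + 1)).eval x ∂(gaussianReal 0 1) =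
      ∫ x, deriv F x * (hermiteR k).eval x ∂(gaussianReal 0 1) := by
  set p := hermiteR k
  have hp (q : Polynomial ℝ) : Integrable (fun x => F x * q.eval x) (gaussianReal 0 1) :=
    h1.integrable_mul (memLp_eval_gaussianReal q)
  have hp' (q : Polynomial ℝ) : Integrable (fun x => deriv F x * q.eval x) (gaussianReal 0 1) :=
    h2.integrable_mul (memLp_eval_gaussianReal q)
  have hd : deriv (fun x => F x * p.eval x) =ᵐ[gaussianReal 0 1]
      fun x => deriv F x * p.eval x + F x * p.derivative.eval x := by
    refine (gaussianReal_absolutelyContinuous 0 one_ne_zero).ae_le ?_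
    filter_upwards [ae_differentiableAt_of_absolutelyContinuous hF] with x hx
    exact (hx.hasDerivAt.fun_mul (p.hasDerivAt x)).deriv
  have hX : (fun x => x * (F x * p.eval x)) = fun x => F x * (Polynomial.X * p).eval x := by
    ext x; simp; ring
  have key := integral_id_mul_gaussianReal_eq_integral_deriv
    (fun a b => (hF a b).fun_mul (absolutelyContinuousOnInterval_eval p a b)) (hp p)
    (((hp' p).add (hp p.derivative)).congr hd.symm) (by rw [hX]; exact hp _)
  rw [integral_congr_ae hd, integral_add (hp' p) (hp _), hX] at key
  rw [hermiteR_succ]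
  simp only [Polynomial.eval_sub, mul_sub]
  rw [integral_sub (hp _) (hp _)]
  linarith

theorem integral_eval_mul_hermiteR_succ (p : Polynomial ℝ) (k : ℕ) :
    ∫ x, p.eval x * (hermiteR (k + 1)).eval x ∂(gaussianReal 0 1) =
      ∫ x, p.derivative.eval x * (hermiteR k).eval x ∂(gaussianReal 0 1) := by
  have hd : deriv (fun x => p.eval x) = fun x => p.derivative.eval x := by ext; simp
  rw [integral_mul_hermiteR_succ (absolutelyContinuousOnInterval_eval p)
    (memLp_eval_gaussianReal p) (by rw [hd]; exact memLp_eval_gaussianReal _), hd]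

/-- Integration by parts lowers both indices by one and produces the factor `j + 1`; once one index
is `0`, a constant gets differentiated. -/
theorem integral_hermiteR_mul_hermiteR (j k : ℕ) :
    ∫ x, (hermiteR j).eval x * (hermiteR k).eval x ∂(gaussianReal 0 1) =
      if j = k then (k.factorial : ℝ) else 0 := by
  have hzero (k : ℕ) : ∫ x, (hermiteR 0).eval x * (hermiteR (k + 1)).eval x ∂(gaussianReal 0 1)
      = 0 := by
    rw [integral_eval_mul_hermiteR_succ]
    simp [hermiteR_zero]
  induction k generalizing j with
  | zero =>
    cases j with
    | zero => simp [hermiteR_zero]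
    | succ j => simpa [mul_comm] using hzero j
  | succ k ih =>
    cases j with
    | zero => simpa using hzero k
    | succ j =>
      rw [integral_eval_mul_hermiteR_succ, derivative_hermiteR_succ]
      simp only [Polynomial.eval_mul, Polynomial.eval_add, Polynomial.eval_natCast,
        Polynomial.eval_one, mul_assoc]
      rw [integral_const_mul, ih]
      by_cases h : j = k
      · simp [h, Nat.factorial_succ]
      · simp [h]

/-- Hermite polynomials are eigenfunctions of the Ornstein–Uhlenbeck semigroup. -/
theorem integral_hermiteR_mehler {ρ c : ℝ} (h : ρ ^ 2 + c ^ 2 = 1) (x : ℝ) (k : ℕ) :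
    ∫ z, (hermiteR k).eval (ρ * x + c * z) ∂(gaussianReal 0 1) =
      ρ ^ k * (hermiteR k).eval x := by
  have hcomp (p : Polynomial ℝ) (z : ℝ) : p.eval (ρ * x + c * z) =
      (p.comp (Polynomial.C (ρ * x) + Polynomial.C c * Polynomial.X)).eval z := by simp
  have hint (p : Polynomial ℝ) :
      Integrable (fun z => p.eval (ρ * x + c * z)) (gaussianReal 0 1) := by
    simp only [hcomp]
    exact integrable_eval_gaussianReal _
  have hintz (p : Polynomial ℝ) :
      Integrable (fun z => z * p.eval (ρ * x + c * z)) (gaussianReal 0 1) := by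
    convert! integrable_eval_gaussianReal
      (Polynomial.X * p.comp (Polynomial.C (ρ * x) + Polynomial.C c * Polynomial.X)) using 2
    simp
  have hstein (p : Polynomial ℝ) : ∫ z, z * p.eval (ρ * x + c * z) ∂(gaussianReal 0 1) =
      c * ∫ z, p.derivative.eval (ρ * x + c * z) ∂(gaussianReal 0 1) := by
    have h1 := integral_eval_mul_hermiteR_succ
      (p.comp (Polynomial.C (ρ * x) + Polynomial.C c * Polynomial.X)) 0
    rw [hermiteR_zero, zero_add, hermiteR_one] at h1
    rw [← integral_const_mul]
    convert! h1 using 2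
    · ext z
      simp [mul_comm z]
    · ext z
      simp [Polynomial.derivative_comp]
  induction k using Nat.strong_induction_on with
  | _ k ih =>
    cases k with
    | zero => simp [hermiteR_zero]
    | succ k =>
      -- The extra factor `ρ` raises the power from the induction hypothesis to `ρ ^ k` and avoids
      -- division by a possibly zero `ρ`.
      have hder : (∫ z, (hermiteR k).derivative.eval (ρ * x + c * z) ∂(gaussianReal 0 1)) * ρ =
          ρ ^ k * (hermiteR k).derivative.eval x := by
        cases k with
        | zero => simp [hermiteR_zero]
        | succ k =>
          simp only [derivative_hermiteR_succ, Polynomial.eval_mul, Polynomial.eval_add,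
            Polynomial.eval_natCast, Polynomial.eval_one]
          rw [integral_const_mul, ih k (by omega)]
          ring
      have e : (fun z => (hermiteR (k + 1)).eval (ρ * x + c * z)) = fun z =>
          ρ * x * (hermiteR k).eval (ρ * x + c * z) + c * (z * (hermiteR k).eval (ρ * x + c * z)) -
            (hermiteR k).derivative.eval (ρ * x + c * z) := by
        ext z
        rw [hermiteR_succ]
        simp
        ring
      have hsum : Integrable (fun z => ρ * x * (hermiteR k).eval (ρ * x + c * z) +
          c * (z * (hermiteR k).eval (ρ * x + c * z))) (gaussianReal 0 1) :=
        ((hint _).const_mul _).add ((hintz _).const_mul _)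
      rw [e, integral_sub hsum (hint _), integral_add ((hint _).const_mul _) ((hintz _).const_mul _),
        integral_const_mul,
        integral_const_mul, hstein, ih k (by omega), hermiteR_succ]
      simp only [Polynomial.eval_sub, Polynomial.eval_mul, Polynomial.eval_X]
      rw [show c * (c * ∫ z, (hermiteR k).derivative.eval (ρ * x + c * z) ∂(gaussianReal 0 1)) =
        c ^ 2 * ∫ z, (hermiteR k).derivative.eval (ρ * x + c * z) ∂(gaussianReal 0 1) by ring,
        show c ^ 2 = 1 - ρ ^ 2 by linarith]
      linear_combination (-ρ) * hder

theorem measurePreserving_gaussian_rotation {ρ c : ℝ} (h : ρ ^ 2 + c ^ 2 = 1) :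
    MeasurePreserving (fun w : ℝ × ℝ => ρ * w.1 + c * w.2)
      ((gaussianReal 0 1).prod (gaussianReal 0 1)) (gaussianReal 0 1) := by
  refine ⟨by fun_prop, ?_⟩
  have e : (fun w : ℝ × ℝ => ρ * w.1 + c * w.2) =
      (fun w : ℝ × ℝ => w.1 + w.2) ∘ Prod.map (ρ * ·) (c * ·) := rfl
  rw [e, ← Measure.map_map (by fun_prop) (by fun_prop),
    ← Measure.map_prod_map _ _ (by fun_prop) (by fun_prop), gaussianReal_map_const_mul,
    gaussianReal_map_const_mul]
  have hconv := gaussianReal_conv_gaussianReal (m₁ := ρ * 0) (m₂ := c * 0)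
    (v₁ := .mk (ρ ^ 2) (sq_nonneg _) * 1) (v₂ := .mk (c ^ 2) (sq_nonneg _) * 1)
  rw [Measure.conv] at hconv
  rw [hconv]
  congr 1
  · simp
  · ext
    simpa using h

theorem integral_hermiteR_correlation {ρ c : ℝ} (h : ρ ^ 2 + c ^ 2 = 1) (j k : ℕ) :
    ∫ w : ℝ × ℝ, (hermiteR j).eval w.1 * (hermiteR k).eval (ρ * w.1 + c * w.2)
      ∂((gaussianReal 0 1).prod (gaussianReal 0 1)) =
      if j = k then ρ ^ k * (k.factorial : ℝ) else 0 := by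
  have h1 := (memLp_eval_gaussianReal (hermiteR j)).comp_measurePreserving
    (measurePreserving_fst (μ := gaussianReal 0 1) (ν := gaussianReal 0 1))
  have h2 := (memLp_eval_gaussianReal (hermiteR k)).comp_measurePreserving
    (measurePreserving_gaussian_rotation h)
  have hint : Integrable (fun w : ℝ × ℝ =>
      (hermiteR j).eval w.1 * (hermiteR k).eval (ρ * w.1 + c * w.2))
      ((gaussianReal 0 1).prod (gaussianReal 0 1)) := h1.integrable_mul h2
  rw [integral_prod _ hint]
  simp only [integral_const_mul, integral_hermiteR_mehler h]
  simp only [mul_left_comm _ (ρ ^ k)]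
  rw [integral_const_mul, integral_hermiteR_mul_hermiteR]
  split_ifs <;> simp

/-! ### Completeness of the Hermite polynomials. -/

theorem integral_mul_eval_eq_zero {f : ℝ → ℝ} (hf : MemLp f 2 (gaussianReal 0 1))
    (h : ∀ k, ∫ x, f x * (hermiteR k).eval x ∂(gaussianReal 0 1) = 0) (p : Polynomial ℝ) :
    ∫ x, f x * p.eval x ∂(gaussianReal 0 1) = 0 := by
  let S : Polynomial.Sequence ℝ := ⟨hermiteR, degree_hermiteR⟩
  have hspan := S.span fun i => (Polynomial.leadingCoeff_ne_zero.2 (S.ne_zero i)).isUnit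
  have hp : p ∈ Submodule.span ℝ (Set.range S) := hspan ▸ Submodule.mem_top
  have hint (q : Polynomial ℝ) : Integrable (fun x => f x * q.eval x) (gaussianReal 0 1) :=
    hf.integrable_mul (memLp_eval_gaussianReal q)
  induction hp using Submodule.span_induction with
  | mem q hq =>
    obtain ⟨k, rfl⟩ := hq
    exact h k
  | zero => simp
  | add q r _ _ hq hr =>
    simp only [Polynomial.eval_add, mul_add]
    rw [integral_add (hint q) (hint r), hq, hr, add_zero]
  | smul a q _ hq =>
    simp only [Polynomial.eval_smul, smul_eq_mul, mul_left_comm _ a]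
    rw [integral_const_mul, hq, mul_zero]

/-- Paired with `f ∈ L²`, this provides the integrable majorant for expanding the Fourier transform
into moments. -/
theorem memLp_exp_abs_gaussianReal (t : ℝ) :
    MemLp (fun x => Real.exp |t * x|) 2 (gaussianReal 0 1) := by
  rw [memLp_two_iff_integrable_sq (by fun_prop)]
  refine ((integrable_exp_mul_gaussianReal (2 * t)).add
    (integrable_exp_mul_gaussianReal (-(2 * t)))).mono' (by fun_prop) (ae_of_all _ fun x => ?_)
  rw [Real.norm_of_nonneg (by positivity), ← Real.exp_nat_mul, Pi.add_apply]
  have h1 := Real.exp_pos (2 * t * x)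
  have h2 := Real.exp_pos (-(2 * t) * x)
  push_cast
  rcases abs_cases (t * x) with ⟨h, _⟩ | ⟨h, _⟩ <;> rw [h]
  · rw [show 2 * (t * x) = 2 * t * x by ring]; linarith
  · rw [show 2 * -(t * x) = -(2 * t) * x by ring]; linarith

/-- The Fourier transform of `f dγ` vanishes if all moments of `f dγ` vanish. -/
theorem integral_mul_cexp_eq_zero {f : ℝ → ℝ} (hf : MemLp f 2 (gaussianReal 0 1))
    (h : ∀ n : ℕ, ∫ x, f x * x ^ n ∂(gaussianReal 0 1) = 0) (t : ℝ) :
    ∫ x, (f x : ℂ) * Complex.exp (t * x * Complex.I) ∂(gaussianReal 0 1) = 0 := by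
  have hs := hasSum_integral_of_dominated_convergence (μ := gaussianReal 0 1)
    (F := fun (n : ℕ) (x : ℝ) => (f x : ℂ) * ((t * x * Complex.I) ^ n / (n.factorial : ℂ)))
    (f := fun x => (f x : ℂ) * Complex.exp (t * x * Complex.I))
    (fun n x => |f x| * (|t * x| ^ n / n.factorial)) (fun n => ?_) (fun n => ?_) ?_ ?_ ?_
  · refine hs.unique ?_
    convert! hasSum_zero using 1
    ext n
    have e (x : ℝ) : (f x : ℂ) * ((t * x * Complex.I) ^ n / (n.factorial : ℂ)) =
        ((t * Complex.I) ^ n / (n.factorial : ℂ)) * ((f x * x ^ n : ℝ) : ℂ) := by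
      push_cast; ring
    simp only [e]
    rw [integral_const_mul, integral_complex_ofReal, h]
    simp
  · exact (Complex.continuous_ofReal.comp_aestronglyMeasurable hf.1).mul
      (by fun_prop)
  · refine ae_of_all _ fun x => le_of_eq ?_
    simp [abs_mul]
  · exact ae_of_all _ fun x => (Real.summable_pow_div_factorial _).mul_left _
  · have e (x : ℝ) : ∑' n : ℕ, |f x| * (|t * x| ^ n / n.factorial) = |f x| * Real.exp |t * x| := by
      rw [tsum_mul_left, Real.exp_eq_exp_ℝ, NormedSpace.exp_eq_tsum_div]
    simp only [e]
    exact hf.abs.integrable_mul (memLp_exp_abs_gaussianReal t)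
  · refine ae_of_all _ fun x => HasSum.mul_left _ ?_
    rw [Complex.exp_eq_exp_ℂ]
    exact NormedSpace.expSeries_div_hasSum_exp _

/-- A real function whose product with a finite measure has vanishing Fourier transform is zero. -/
theorem ae_eq_zero_of_integral_mul_cexp_eq_zero {ν : Measure ℝ} {f : ℝ → ℝ} (hf : Integrable f ν)
    (h : ∀ t : ℝ, ∫ x, (f x : ℂ) * Complex.exp (t * x * Complex.I) ∂ν = 0) : f =ᵐ[ν] 0 := by
  have hm : AEMeasurable f ν := hf.1.aemeasurable
  have hfin (g : ℝ → ℝ) (hg : Integrable g ν) : ∫⁻ x, ENNReal.ofReal (g x) ∂ν ≠ ⊤ :=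
    hg.lintegral_lt_top.ne
  have : IsFiniteMeasure (ν.withDensity fun x => ENNReal.ofReal (f x)) :=
    isFiniteMeasure_withDensity (hfin f hf)
  have : IsFiniteMeasure (ν.withDensity fun x => ENNReal.ofReal (-f x)) :=
    isFiniteMeasure_withDensity (hfin _ hf.neg)
  have hchar (g : ℝ → ℝ) (hg : Integrable g ν) (t : ℝ) :
      charFun (ν.withDensity fun x => ENNReal.ofReal (g x)) t =
        ∫ x, ((max (g x) 0 : ℝ) : ℂ) * Complex.exp (t * x * Complex.I) ∂ν := by
    rw [charFun_apply_real, integral_withDensity_eq_integral_toReal_smul₀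
      hg.1.aemeasurable.ennreal_ofReal (ae_of_all _ fun _ => ENNReal.ofReal_lt_top)]
    simp [ENNReal.toReal_ofReal']
  have hint (g : ℝ → ℝ) (hg : Integrable g ν) (t : ℝ) :
      Integrable (fun x => ((max (g x) 0 : ℝ) : ℂ) * Complex.exp (t * x * Complex.I)) ν := by
    refine (hg.pos_part.ofReal (𝕜 := ℂ)).mul_bdd (c := 1) (by fun_prop) (ae_of_all _ fun x => ?_)
    rw [← Complex.ofReal_mul, Complex.norm_exp_ofReal_mul_I]
  -- The positive and negative parts of `f` are densities of finite measures with equal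
  -- characteristic functions.
  have heq : (ν.withDensity fun x => ENNReal.ofReal (f x)) =
      ν.withDensity fun x => ENNReal.ofReal (-f x) := by
    refine Measure.ext_of_charFun (funext fun t => ?_)
    rw [hchar f hf, hchar (fun x => -f x) hf.neg, ← sub_eq_zero,
      ← integral_sub (hint f hf t) (hint (fun x => -f x) hf.neg t), ← h t]
    congr 1 with x
    rw [← sub_mul, ← Complex.ofReal_sub, max_zero_sub_eq_self]
  rw [withDensity_eq_iff hm.ennreal_ofReal
    (show AEMeasurable (fun x => -f x) ν from hm.neg).ennreal_ofReal (hfin f hf)] at heq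
  filter_upwards [heq] with x hx
  have := congrArg ENNReal.toReal hx
  rw [ENNReal.toReal_ofReal', ENNReal.toReal_ofReal'] at this
  rw [Pi.zero_apply, ← max_zero_sub_eq_self (f x), max_comm, max_comm (-f x), sub_eq_zero]
  simpa [max_comm] using this

/-- The Hermite polynomials are complete in `L²(γ)`. -/
theorem ae_eq_zero_of_hermite_coeff_eq_zero {f : ℝ → ℝ} (hf : MemLp f 2 (gaussianReal 0 1))
    (h : ∀ k, ∫ x, f x * (hermiteR k).eval x ∂(gaussianReal 0 1) = 0) :
    f =ᵐ[gaussianReal 0 1] 0 := by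
  refine ae_eq_zero_of_integral_mul_cexp_eq_zero (hf.integrable (by norm_num))
    (integral_mul_cexp_eq_zero hf fun n => ?_)
  simpa using integral_mul_eval_eq_zero hf h (Polynomial.X ^ n)

/-! ### The Hermite basis and Mehler's formula for dual functions. -/

/-- The normalized Hermite polynomials `He_k / √(k!)`. -/
noncomputable def hermiteN (k : ℕ) : Polynomial ℝ :=
  Polynomial.C (√(k.factorial : ℝ))⁻¹ * hermiteR k

theorem eval_hermiteN (k : ℕ) (x : ℝ) :
    (hermiteN k).eval x = (√(k.factorial : ℝ))⁻¹ * (hermiteR k).eval x := by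
  simp [hermiteN]

theorem integral_hermiteN_correlation {ρ c : ℝ} (h : ρ ^ 2 + c ^ 2 = 1) (j k : ℕ) :
    ∫ w : ℝ × ℝ, (hermiteN j).eval w.1 * (hermiteN k).eval (ρ * w.1 + c * w.2)
      ∂((gaussianReal 0 1).prod (gaussianReal 0 1)) = if j = k then ρ ^ k else 0 := by
  simp only [eval_hermiteN, fun u v => mul_mul_mul_comm (√(j.factorial : ℝ))⁻¹ u
    (√(k.factorial : ℝ))⁻¹ v]
  rw [integral_const_mul, integral_hermiteR_correlation h]
  split_ifs with hjk
  · subst hjk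
    have : (0 : ℝ) < j.factorial := by exact_mod_cast j.factorial_pos
    rw [← mul_inv, Real.mul_self_sqrt this.le]
    field_simp
  · simp

theorem integral_hermiteN_mul_hermiteN (j k : ℕ) :
    ∫ x, (hermiteN j).eval x * (hermiteN k).eval x ∂(gaussianReal 0 1) =
      if j = k then 1 else 0 := by
  simp only [eval_hermiteN, fun u v => mul_mul_mul_comm (√(j.factorial : ℝ))⁻¹ u
    (√(k.factorial : ℝ))⁻¹ v]
  rw [integral_const_mul, integral_hermiteR_mul_hermiteR]
  split_ifs with hjk
  · subst hjk
    have : (0 : ℝ) < j.factorial := by exact_mod_cast j.factorial_pos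
    rw [← mul_inv, Real.mul_self_sqrt this.le]
    field_simp
  · simp

theorem inner_toLp_toLp {α : Type*} [MeasurableSpace α] {ν : Measure α} {f g : α → ℝ}
    (hf : MemLp f 2 ν) (hg : MemLp g 2 ν) :
    inner ℝ (hf.toLp f) (hg.toLp g) = ∫ x, f x * g x ∂ν := by
  rw [L2.inner_def]
  refine integral_congr_ae ?_
  filter_upwards [hf.coeFn_toLp, hg.coeFn_toLp] with x h1 h2
  simp [h1, h2, mul_comm]

/-- The normalized Hermite polynomials as elements of `L²(γ)`. -/
noncomputable def hermiteLp (k : ℕ) : Lp ℝ 2 (gaussianReal 0 1) :=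
  (memLp_eval_gaussianReal (hermiteN k)).toLp _

theorem orthonormal_hermiteLp : Orthonormal ℝ hermiteLp := by
  rw [orthonormal_iff_ite]
  intro j k
  rw [hermiteLp, hermiteLp, inner_toLp_toLp, integral_hermiteN_mul_hermiteN]

theorem orthogonal_span_hermiteLp : (Submodule.span ℝ (Set.range hermiteLp))ᗮ = ⊥ := by
  rw [Submodule.eq_bot_iff]
  intro f hf
  rw [Submodule.mem_orthogonal] at hf
  have hfm := Lp.memLp f
  rw [Lp.eq_zero_iff_ae_eq_zero]
  refine ae_eq_zero_of_hermite_coeff_eq_zero hfm fun k => ?_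
  have h := hf _ (Submodule.subset_span ⟨k, rfl⟩)
  rw [hermiteLp, ← Lp.toLp_coeFn f hfm, inner_toLp_toLp] at h
  simp only [eval_hermiteN, mul_assoc] at h
  rw [integral_const_mul] at h
  have hk : (√(k.factorial : ℝ))⁻¹ ≠ 0 := by positivity
  simpa [mul_comm] using (mul_eq_zero.1 h).resolve_left hk

/-- The Hilbert basis of `L²(γ)` given by the normalized Hermite polynomials. -/
noncomputable def hermiteBasis : HilbertBasis ℕ ℝ (Lp ℝ 2 (gaussianReal 0 1)) :=
  HilbertBasis.mkOfOrthogonalEqBot orthonormal_hermiteLp orthogonal_span_hermiteLp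

theorem hermiteBasis_apply (k : ℕ) : hermiteBasis k = hermiteLp k := by
  simp [hermiteBasis]

/-- The normalized Hermite coefficients `𝔼[f h_k]`. -/
noncomputable def hermiteCoeff (f : ℝ → ℝ) (k : ℕ) : ℝ :=
  ∫ x, f x * (hermiteN k).eval x ∂(gaussianReal 0 1)

theorem inner_hermiteBasis {f : ℝ → ℝ} (hf : MemLp f 2 (gaussianReal 0 1)) (k : ℕ) :
    inner ℝ (hermiteBasis k) (hf.toLp f) = hermiteCoeff f k := by
  rw [hermiteBasis_apply, hermiteLp, inner_toLp_toLp]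
  simp [hermiteCoeff, mul_comm]

/-- Mehler's formula: `f̂(ρ) = ∑ a_k² ρ^k`. -/
theorem hasSum_dualActivation {f : ℝ → ℝ} (hf : MemLp f 2 (gaussianReal 0 1)) {ρ : ℝ}
    (hρ : |ρ| ≤ 1) : HasSum (fun k => hermiteCoeff f k ^ 2 * ρ ^ k) (dualActivation f ρ) := by
  have hc : ρ ^ 2 + √(1 - ρ ^ 2) ^ 2 = 1 := by
    rw [Real.sq_sqrt (by nlinarith [abs_le.1 hρ])]; ring
  have m1 := measurePreserving_fst (μ := gaussianReal 0 1) (ν := gaussianReal 0 1)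
  have m2 := measurePreserving_gaussian_rotation hc
  -- `A` and `B` pull functions back along the two correlated Gaussian coordinates. Thus `f̂(ρ) = ⟪A
  -- f, B f⟫`, and the Hermite basis diagonalizes this form with entries `ρ ^ k`.
  let A := Lp.compMeasurePreservingₗᵢ ℝ (E := ℝ) (p := 2) _ m1
  let B := Lp.compMeasurePreservingₗᵢ ℝ (E := ℝ) (p := 2) _ m2
  have hA {g : ℝ → ℝ} (hg : MemLp g 2 (gaussianReal 0 1)) :
      A (hg.toLp g) = (hg.comp_measurePreserving m1).toLp _ := Lp.toLp_compMeasurePreserving hg m1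
  have hB {g : ℝ → ℝ} (hg : MemLp g 2 (gaussianReal 0 1)) :
      B (hg.toLp g) = (hg.comp_measurePreserving m2).toLp _ := Lp.toLp_compMeasurePreserving hg m2
  have hAB (j k : ℕ) : inner ℝ (A (hermiteBasis j)) (B (hermiteBasis k)) =
      if j = k then ρ ^ k else 0 := by
    rw [hermiteBasis_apply, hermiteBasis_apply, hermiteLp, hermiteLp, hA, hB, inner_toLp_toLp]
    exact integral_hermiteN_correlation hc j k
  have hrep := hermiteBasis.hasSum_repr (hf.toLp f)
  simp only [HilbertBasis.repr_apply_apply, inner_hermiteBasis] at hrep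
  have hAf : inner ℝ (A (hf.toLp f)) (B (hf.toLp f)) = dualActivation f ρ := by
    rw [hA, hB, inner_toLp_toLp]
    rfl
  have hjB (j : ℕ) : inner ℝ (A (hermiteBasis j)) (B (hf.toLp f)) = hermiteCoeff f j * ρ ^ j := by
    have h1 := ((innerSL ℝ (A (hermiteBasis j))).comp B.toContinuousLinearMap).hasSum hrep
    have h2 := hasSum_ite_eq j (hermiteCoeff f j * ρ ^ j)
    refine HasSum.unique h1 ?_
    convert! h2 using 2 with k
    simp only [ContinuousLinearMap.comp_apply, innerSL_apply_apply, map_smul,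
      LinearIsometry.coe_toContinuousLinearMap, hAB, smul_eq_mul]
    by_cases hjk : k = j
    · simp [hjk]
    · simp [hjk, Ne.symm hjk]
  have h3 := ((innerSL ℝ (B (hf.toLp f))).comp A.toContinuousLinearMap).hasSum hrep
  rw [← hAf, real_inner_comm]
  convert! h3 using 2 with k
  simp only [ContinuousLinearMap.comp_apply, innerSL_apply_apply, map_smul,
      LinearIsometry.coe_toContinuousLinearMap, smul_eq_mul]
  rw [real_inner_comm, hjB]
  ring

/-! ### Bounds on the dual functions of a normalized activation. -/

theorem dualActivation_one (f : ℝ → ℝ) :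
    dualActivation f 1 = ∫ x, f x ^ 2 ∂(gaussianReal 0 1) := by
  have h := integral_fun_fst (μ := gaussianReal 0 1) (ν := gaussianReal 0 1) (fun x => f x ^ 2)
  simpa [dualActivation, sq] using h

/-- All powers `|ρ| ^ k` with `k ≥ 1` are at most `|ρ|`; only the constant term escapes this gain.
-/
theorem abs_le_of_hasSum_mul_pow {c : ℕ → ℝ} (hc : ∀ k, 0 ≤ c k) {ρ S T : ℝ} (hρ : |ρ| ≤ 1)
    (hT : HasSum c T) (hS : HasSum (fun k => c k * ρ ^ k) S) :
    |S| ≤ c 0 + |ρ| * (T - c 0) := by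
  have hB : HasSum (fun k => |ρ| * c k + if k = 0 then (1 - |ρ|) * c 0 else 0)
      (|ρ| * T + (1 - |ρ|) * c 0) := (hT.mul_left _).add (hasSum_ite_eq 0 _)
  have hle (k : ℕ) : |c k * ρ ^ k| ≤ |ρ| * c k + if k = 0 then (1 - |ρ|) * c 0 else 0 := by
    rw [abs_mul, abs_of_nonneg (hc k), abs_pow]
    cases k with
    | zero => simp; linarith
    | succ k =>
      have : |ρ| ^ (k + 1) ≤ |ρ| := pow_le_of_le_one (abs_nonneg _) hρ (by simp)
      simpa [mul_comm] using mul_le_mul_of_nonneg_left this (hc (k + 1))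
  have h1 := hasSum_le (fun k => (abs_le.1 (hle k)).2) hS hB
  have h2 := hasSum_le (fun k => (abs_le.1 (hle k)).1) hB.neg hS
  rw [abs_le]
  constructor <;> linarith

theorem hermiteCoeff_deriv {F : ℝ → ℝ} (hF : ∀ a b, AbsolutelyContinuousOnInterval F a b)
    (h1 : MemLp F 2 (gaussianReal 0 1)) (h2 : MemLp (deriv F) 2 (gaussianReal 0 1)) (k : ℕ) :
    hermiteCoeff (deriv F) k = √((k : ℝ) + 1) * hermiteCoeff F (k + 1) := by
  have hk : (0 : ℝ) < k + 1 := by positivity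
  simp only [hermiteCoeff, eval_hermiteN, mul_left_comm _ (√_)⁻¹]
  rw [integral_const_mul, integral_const_mul, integral_mul_hermiteR_succ hF h1 h2,
    Nat.factorial_succ]
  push_cast
  rw [Real.sqrt_mul hk.le]
  have : √((k : ℝ) + 1) ≠ 0 := (Real.sqrt_pos.2 hk).ne'
  field_simp

theorem hermiteCoeff_one (σ : ℝ → ℝ) : hermiteCoeff σ 1 ^ 2 = 1 - nonlinearityCoeff σ := by
  simp [hermiteCoeff, eval_hermiteN, hermiteR_one, nonlinearityCoeff, mul_comm]

theorem nonlinearityCoeff_le_one (σ : ℝ → ℝ) : nonlinearityCoeff σ ≤ 1 := by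
  have := sq_nonneg (∫ t, t * σ t ∂(gaussianReal 0 1))
  unfold nonlinearityCoeff
  linarith

namespace IsNormalizedActivation

variable {σ : ℝ → ℝ} (hσ : IsNormalizedActivation σ)
include hσ

theorem continuous : Continuous σ := by
  refine continuous_iff_continuousAt.2 fun x => ?_
  refine (hσ.absolutelyContinuous (x - 1) (x + 1)).continuousOn.continuousAt ?_
  rw [Set.uIcc_of_le (by linarith)]
  exact Icc_mem_nhds (by linarith) (by linarith)

theorem memLp : MemLp σ 2 (gaussianReal 0 1) := by
  rw [memLp_two_iff_integrable_sq hσ.continuous.aestronglyMeasurable]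
  -- Otherwise the second moment would take the default value `0` of the integral instead of `1`.
  by_contra h
  have := hσ.second_moment_eq_one
  rw [integral_undef h] at this
  exact zero_ne_one this

theorem hermiteCoeff_zero : hermiteCoeff σ 0 = 0 := by
  simpa [hermiteCoeff, eval_hermiteN, hermiteR_zero] using hσ.mean_eq_zero

theorem dualActivation_one_eq_one : dualActivation σ 1 = 1 :=
  (dualActivation_one σ).trans hσ.second_moment_eq_one

theorem hasSum_dualActivation_succ {ρ : ℝ} (hρ : |ρ| ≤ 1) :
    HasSum (fun k => hermiteCoeff σ (k + 1) ^ 2 * ρ ^ (k + 1)) (dualActivation σ ρ) := by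
  have h := (hasSum_nat_add_iff' 1).2 (hasSum_dualActivation hσ.memLp hρ)
  simpa [hσ.hermiteCoeff_zero] using h

theorem hasSum_sq_hermiteCoeff : HasSum (fun k => hermiteCoeff σ (k + 1) ^ 2) 1 := by
  have h := hσ.hasSum_dualActivation_succ (ρ := 1) (by simp)
  simpa [hσ.dualActivation_one_eq_one] using h

theorem hasSum_dualActivation_deriv {ρ : ℝ} (hρ : |ρ| ≤ 1) :
    HasSum (fun k : ℕ => ((k : ℝ) + 1) * hermiteCoeff σ (k + 1) ^ 2 * ρ ^ k)
      (dualActivation (deriv σ) ρ) := by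
  have h := hasSum_dualActivation hσ.memLp_deriv hρ
  refine h.congr_fun fun k => ?_
  rw [hermiteCoeff_deriv hσ.absolutelyContinuous hσ.memLp hσ.memLp_deriv, mul_pow,
    Real.sq_sqrt (by positivity)]

/-- The Gaussian Poincaré inequality for a normalized activation. -/
theorem one_le_dualActivation_deriv_one : 1 ≤ dualActivation (deriv σ) 1 := by
  refine hasSum_le (fun k => ?_) hσ.hasSum_sq_hermiteCoeff
    (hσ.hasSum_dualActivation_deriv (ρ := 1) (by simp))
  have := sq_nonneg (hermiteCoeff σ (k + 1))
  have hk : (0 : ℝ) ≤ k := by positivity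
  simp only [one_pow, mul_one]
  nlinarith

/-- As `a_0 = 0`, a factor `ρ` splits off; the remaining series has constant term `a_1² = 1 - μ` and
total mass `1`. -/
theorem abs_dualActivation_le {ρ : ℝ} (hρ : |ρ| ≤ 1) :
    |dualActivation σ ρ| ≤ logisticStep (nonlinearityCoeff σ) |ρ| := by
  have hT := hσ.hasSum_sq_hermiteCoeff
  have hs : Summable fun k => hermiteCoeff σ (k + 1) ^ 2 * ρ ^ k := by
    refine Summable.of_norm_bounded hT.summable fun k => ?_
    rw [Real.norm_eq_abs, abs_mul, abs_of_nonneg (sq_nonneg _), abs_pow]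
    exact mul_le_of_le_one_right (sq_nonneg _) (pow_le_one₀ (abs_nonneg _) hρ)
  have hb := abs_le_of_hasSum_mul_pow (fun k => sq_nonneg _) hρ hT hs.hasSum
  have he : dualActivation σ ρ = ρ * ∑' k, hermiteCoeff σ (k + 1) ^ 2 * ρ ^ k := by
    refine (hσ.hasSum_dualActivation_succ hρ).unique ?_
    convert! hs.hasSum.mul_left ρ using 2 with k
    ring
  rw [zero_add, hermiteCoeff_one] at hb
  rw [he, abs_mul, logisticStep]
  refine mul_le_mul_of_nonneg_left (hb.trans (le_of_eq ?_)) (abs_nonneg _)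
  ring

theorem abs_dualActivation_deriv_le {ρ : ℝ} (hρ : |ρ| ≤ 1) :
    |dualActivation (deriv σ) ρ| ≤
      dualActivation (deriv σ) 1 * (1 - nonlinearityCoeff σ * (1 - |ρ|)) := by
  have hT := hσ.hasSum_dualActivation_deriv (ρ := 1) (by simp)
  simp only [one_pow, mul_one] at hT
  have hb := abs_le_of_hasSum_mul_pow (fun k => by positivity) hρ hT
    (hσ.hasSum_dualActivation_deriv hρ)
  simp only [Nat.cast_zero, zero_add, one_mul, hermiteCoeff_one] at hb
  have hM := hσ.one_le_dualActivation_deriv_one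
  have hμ := nonlinearityCoeff_le_one σ
  -- The slack over the power series bound is `(M - 1)(1 - μ)(1 - |ρ|)`, with `M` the value at `1`;
  -- this is where the Poincaré inequality `M ≥ 1` enters.
  nlinarith [mul_nonneg (mul_nonneg (sub_nonneg.2 hM) (sub_nonneg.2 hμ)) (sub_nonneg.2 hρ)]

end IsNormalizedActivation

/-! ### The kernel matrix and the main theorem. -/

section kernel

variable {σ : ℝ → ℝ} (hσ : IsNormalizedActivation σ) {s n d : ℕ}
  {x : Fin n → EuclideanSpace ℝ (Fin d)} {δ : ℝ} (hx : IsSeparatedDataset x δ) (L : ℕ)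

include hx in
theorem ntkMatrix_diag (i : Fin n) : ntkMatrix σ s L x i i = ntk σ s L 1 := by
  simp [ntkMatrix, hx.norm_eq_one]

include hσ in
theorem ntk_one_pos : 0 < ntk σ s L 1 :=
  ntkSum_one_pos hσ.dualActivation_one_eq_one
    (zero_le_one.trans hσ.one_le_dualActivation_deriv_one) s L

include hσ hx in
theorem abs_eigenvalue_ntkMatrix_sub_le (hμ : 0 < nonlinearityCoeff σ) (hs : s ≤ 1) (hn : 1 ≤ n)
    (hL : convDepth σ n δ ≤ L) {t : ℝ}
    (ht : Module.End.HasEigenvalue (Matrix.toLin' (ntkMatrix σ s L x)) t) :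
    |t - ntk σ s L 1| ≤ ntk σ s L 1 / n := by
  have hoff (i j : Fin n) (hij : i ≠ j) :
      |ntkMatrix σ s L x i j| ≤ ntk σ s L 1 / (n : ℝ) ^ 2 :=
    abs_ntkSum_le_of_separated hμ (nonlinearityCoeff_le_one σ)
      (fun _ h => hσ.abs_dualActivation_le h) (fun _ h => hσ.abs_dualActivation_deriv_le h)
      hσ.dualActivation_one_eq_one (zero_le_one.trans hσ.one_le_dualActivation_deriv_one) hs
      hx.pos hx.le_one hn hL (hx.le_separability i j hij)
  have hn0 : (0 : ℝ) < n := by exact_mod_cast hn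
  refine (abs_eigenvalue_sub_le_of_offDiag_le (ntkMatrix_diag hx L) hoff ht).trans ?_
  have hK := (ntk_one_pos hσ (s := s) L).le
  calc ((n : ℝ) - 1) * (ntk σ s L 1 / (n : ℝ) ^ 2) ≤ n * (ntk σ s L 1 / (n : ℝ) ^ 2) := by
        gcongr
        linarith
    _ = ntk σ s L 1 / n := by field_simp

include hσ hx in
theorem condNumber_ntkMatrix_mem (hμ : 0 < nonlinearityCoeff σ) (hs : s ≤ 1) (hn : 2 ≤ n)
    (hL : convDepth σ n δ ≤ L) :
    1 ≤ condNumber (ntkMatrix σ s L x) ∧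
      condNumber (ntkMatrix σ s L x) ≤ (1 + 1 / n) / (1 - 1 / n) :=
  condNumber_mem_Icc hn (ntkMatrix_isHermitian σ s L x) (ntk_one_pos hσ L) fun _ ht =>
    abs_eigenvalue_ntkMatrix_sub_le hσ hx L hμ hs (by omega) hL ht

end kernel

theorem mainTheorem3 (σ : ℝ → ℝ) (hσ : IsNormalizedActivation σ)
    (hμ : 0 < nonlinearityCoeff σ) (s : ℕ) (hs : s ≤ 1) :
    (∀ (n d L : ℕ) (x : Fin n → EuclideanSpace ℝ (Fin d)) (δ : ℝ),
      IsSeparatedDataset x δ → convDepth σ n δ ≤ L →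
        (∀ i j : Fin n,
          ntkMatrix σ s L x i i * (1 - 1 / n) ≤ (ntkMatrix_isHermitian σ s L x).eigenvalues j ∧
          (ntkMatrix_isHermitian σ s L x).eigenvalues j ≤ ntkMatrix σ s L x i i * (1 + 1 / n)) ∧
        (2 ≤ n →
          1 ≤ condNumber (ntkMatrix σ s L x) ∧
          condNumber (ntkMatrix σ s L x) ≤ (1 + 1 / n) / (1 - 1 / n))) ∧
    (∀ (n d L : ℕ → ℕ) (x : ∀ k, Fin (n k) → EuclideanSpace ℝ (Fin (d k))) (δ : ℕ → ℝ),
      Tendsto n atTop atTop →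
      (∀ k, IsSeparatedDataset (x k) (δ k)) → (∀ k, convDepth σ (n k) (δ k) ≤ L k) →
        Tendsto (fun k => condNumber (ntkMatrix σ s (L k) (x k))) atTop (𝓝 1)) := by
  refine ⟨fun n d L x δ hx hL => ⟨fun i j => ?_, fun hn =>
    condNumber_ntkMatrix_mem hσ hx L hμ hs hn hL⟩, fun n d L x δ hn hx hL => ?_⟩
  · have h := abs_le.1 (abs_eigenvalue_ntkMatrix_sub_le hσ hx L hμ hs (Nat.one_le_of_lt i.2) hL
      (hasEigenvalue_toLin'_eigenvalues (ntkMatrix_isHermitian σ s L x) j))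
    rw [ntkMatrix_diag hx]
    have hdiv : ntk σ s L 1 / n = ntk σ s L 1 * (1 / n) := by ring
    constructor <;> linarith
  · have hinv : Tendsto (fun k => 1 / (n k : ℝ)) atTop (𝓝 0) :=
      tendsto_one_div_atTop_nhds_zero_nat.comp hn
    have hlim : Tendsto (fun k => (1 + 1 / (n k : ℝ)) / (1 - 1 / (n k : ℝ))) atTop (𝓝 1) := by
      have := (hinv.const_add 1).div (hinv.const_sub 1) (by norm_num)
      simpa [Pi.div_def] using this
    -- The bounds on the condition number need `n ≥ 2`, so the squeeze holds only eventually.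
    have hev : ∀ᶠ k in atTop, 2 ≤ n k := hn.eventually_ge_atTop 2
    refine tendsto_of_tendsto_of_tendsto_of_le_of_le' tendsto_const_nhds hlim ?_ ?_
    · filter_upwards [hev] with k hk
      exact (condNumber_ntkMatrix_mem hσ (hx k) (L k) hμ hs hk (hL k)).1
    · filter_upwards [hev] with k hk
      exact (condNumber_ntkMatrix_mem hσ (hx k) (L k) hμ hs hk (hL k)).2
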